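/- A triangulated surface is a finite connected simplicial complex in which the link of each vertex is a circle or an interval (the triangulation of a connected compact surface); it is closed if every link is a circle. A vertex is interior if its link is a circle. A triangulated disc is a triangulated surface whose underlying space is a disc, that is, which has nonempty boundary and Euler characteristic $1$. The valence of a vertex is the number of triangles containing it. A closed triangulated surface $\mathcal T$ is a root if no inverse T-move can be applied to it, where an inverse T-move replaces the open star of a $3$-valent vertex by the triangle spanned by the three vertices of its link, and can be applied whenever this triangle is not already in $\mathcal T$. A decomposition of a closed triangulated surface $\mathcal T$ is a triple $(\mathcal G,\mathcal D,\{\mathcal D_1,\dots,\mathcal D_n\})$, $n\ge 0$, where $\mathcal G,\mathcal D,\mathcal D_1,\dots,\mathcal D_n$ are subcomplexes of $\mathcal T$ with union $\mathcal T$, $\mathcal G$ is a triangulated surface, $\mathcal D,\mathcal D_1,\dots,\mathcal D_n$ are triangulated discs, some vertex of maximal valence in $\mathcal T$ is an interior vertex of $\mathcal D$, and any two of these subcomplexes intersect in a triangulated circle or in the empty set. It is minimal if the number of triangles of $\mathcal G$ is the smallest possible among all decompositions of $\mathcal T$. **Proposition.** Let $\mathcal T$ be a closed triangulated surface which is a root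 and has at most $11$ vertices. Then each minimal decomposition of $\mathcal T$ is of the form $(\mathcal G,\mathcal D,\emptyset)$ or of the form $(\mathcal G,\mathcal D,\{\mathcal D_1\})$ where $\mathcal D_1$ has no interior vertex. -/

import Mathlib

/-!
Triangulated compact surfaces are treated as finite abstract simplicial complexes
(`PreAbstractSimplicialComplex V`, whose vertices are the `v : V` with `{v}` a face) in which
every vertex link is a circle or an interval.
-/

namespace TriSurf

variable {V : Type*}

/-- The vertices of the complex `K`. -/
def vertexSet (K : PreAbstractSimplicialComplex V) : Set V :=
  {v | {v} ∈ K.faces}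

/-- The edges of the complex `K`. -/
def edgeSet (K : PreAbstractSimplicialComplex V) : Set (Finset V) :=
  {s | s ∈ K.faces ∧ s.card = 2}

/-- The triangles of the complex `K`. -/
def triangleSet (K : PreAbstractSimplicialComplex V) : Set (Finset V) :=
  {s | s ∈ K.faces ∧ s.card = 3}

/-- The number of vertices of `K`. -/
noncomputable def numVertices (K : PreAbstractSimplicialComplex V) : ℕ :=
  (vertexSet K).ncard

/-- The number of edges of `K`. -/
noncomputable def numEdges (K : PreAbstractSimplicialComplex V) : ℕ :=
  (edgeSet K).ncard

/-- The number of triangles of `K`. -/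
noncomputable def numTriangles (K : PreAbstractSimplicialComplex V) : ℕ :=
  (triangleSet K).ncard

/-- The Euler characteristic of a complex of dimension at most two. -/
noncomputable def eulerChar (K : PreAbstractSimplicialComplex V) : ℤ :=
  (numVertices K : ℤ) - numEdges K + numTriangles K

/-- The valence of `v` in `K`: the number of triangles of `K` containing `v`. -/
noncomputable def valence (K : PreAbstractSimplicialComplex V) (v : V) : ℕ :=
  {s | s ∈ triangleSet K ∧ v ∈ s}.ncard

/-- `v` is a vertex of `K` of maximal valence. -/
def IsMaxValenceVertex (K : PreAbstractSimplicialComplex V) (v : V) : Prop :=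
  v ∈ vertexSet K ∧ ∀ w ∈ vertexSet K, valence K w ≤ valence K v

/-- The link of `v` in `K`: the simplices of the closed star of `v` that do not contain `v`. -/
def link (K : PreAbstractSimplicialComplex V) (v : V) : PreAbstractSimplicialComplex V where
  faces := {s | s ∈ K.faces ∧ v ∉ s ∧ ∃ t ∈ K.faces, v ∈ t ∧ s ⊆ t}
  isRelLowerSet_faces := by
    rintro s ⟨hs, hv, t, ht, hvt, hst⟩
    refine ⟨(K.isRelLowerSet_faces hs).1, fun u hu hne => ?_⟩
    exact ⟨(K.isRelLowerSet_faces hs).2 hu hne, fun h => hv (hu h), t, ht, hvt, hu.trans hst⟩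

/-- The 1-skeleton of `K`, as a graph on the ambient type `V`. -/
def skeletonGraph (K : PreAbstractSimplicialComplex V) : SimpleGraph V where
  Adj u v := ∃ e ∈ edgeSet K, u ∈ e ∧ v ∈ e ∧ u ≠ v
  symm := ⟨fun _ _ ⟨e, he, hu, hv, hne⟩ => ⟨e, he, hv, hu, hne.symm⟩⟩
  loopless := ⟨fun _ ⟨_, _, _, _, hne⟩ => hne rfl⟩

/-- `K` is nonempty and connected. -/
def IsConnectedComplex (K : PreAbstractSimplicialComplex V) : Prop :=
  (vertexSet K).Nonempty ∧
    ∀ u ∈ vertexSet K, ∀ v ∈ vertexSet K, (skeletonGraph K).Reachable u v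

/-- The number of edges of `K` containing `v`. -/
noncomputable def numEdgesAt (K : PreAbstractSimplicialComplex V) (v : V) : ℕ :=
  {e | e ∈ edgeSet K ∧ v ∈ e}.ncard

/-- `K` is a triangulated circle: a finite connected complex of dimension one in which each
vertex lies in exactly two edges. -/
structure IsCircle (K : PreAbstractSimplicialComplex V) : Prop where
  finite : K.faces.Finite
  card_le : ∀ s ∈ K.faces, s.card ≤ 2
  connected : IsConnectedComplex K
  two_edges : ∀ v ∈ vertexSet K, numEdgesAt K v = 2

/-- `K` is a triangulated (nondegenerate, closed) interval: a finite connected complex of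
dimension one in which each vertex lies in one or two edges, and some vertex lies in only one. -/
structure IsInterval (K : PreAbstractSimplicialComplex V) : Prop where
  finite : K.faces.Finite
  card_le : ∀ s ∈ K.faces, s.card ≤ 2
  connected : IsConnectedComplex K
  one_or_two_edges : ∀ v ∈ vertexSet K, numEdgesAt K v = 1 ∨ numEdgesAt K v = 2
  exists_end : ∃ v ∈ vertexSet K, numEdgesAt K v = 1

/-- `K` is a triangulated (connected compact) surface, possibly with boundary. -/
structure IsTriangulatedSurface (K : PreAbstractSimplicialComplex V) : Prop where
  finite : K.faces.Finite
  connected : IsConnectedComplex K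
  link_circle_or_interval :
    ∀ v ∈ vertexSet K, IsCircle (link K v) ∨ IsInterval (link K v)

/-- The vertices of a triangulated surface in the interior of the surface. -/
def interiorVertices (K : PreAbstractSimplicialComplex V) : Set V :=
  {v | v ∈ vertexSet K ∧ IsCircle (link K v)}

/-- The vertices of a triangulated surface on the boundary of the surface. -/
def boundaryVertices (K : PreAbstractSimplicialComplex V) : Set V :=
  {v | v ∈ vertexSet K ∧ IsInterval (link K v)}

/-- `K` is a closed triangulated surface. -/
structure IsClosedTriangulatedSurface (K : PreAbstractSimplicialComplex V) : Prop where
  surface : IsTriangulatedSurface K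
  boundary_empty : boundaryVertices K = ∅

/-- `K` is a triangulated disc. Among connected compact surfaces, the disc is the one with
nonempty boundary and Euler characteristic one. -/
structure IsTriangulatedDisc (K : PreAbstractSimplicialComplex V) : Prop where
  surface : IsTriangulatedSurface K
  boundary_nonempty : (boundaryVertices K).Nonempty
  euler : eulerChar K = 1

/-- `K'` is obtained from `K` by an inverse T-move: there is a 3-valent vertex `v` of `K` such
that the vertex set `t` of its link does not span a triangle of `K`, and the open star of `v` is
replaced with the triangle `t`. -/
def InverseTMove (K K' : PreAbstractSimplicialComplex V) : Prop :=
  ∃ v ∈ vertexSet K, ∃ t : Finset V,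
    valence K v = 3 ∧ vertexSet (link K v) = ↑t ∧ t ∉ K.faces ∧
      K'.faces = {s | s ∈ K.faces ∧ v ∉ s} ∪ {t}

/-- `K` is a root: no inverse T-move can be applied to it. -/
def IsRoot (K : PreAbstractSimplicialComplex V) : Prop :=
  ¬ ∃ K', InverseTMove K K'

/-- `(G, D, 𝒟)` is a decomposition of the closed triangulated surface `T`, with genus-surface
`G`, main disc `D` and finite set `𝒟` of further discs. -/
structure IsDecomposition (T G D : PreAbstractSimplicialComplex V)
    (𝒟 : Set (PreAbstractSimplicialComplex V)) : Prop where
  finite_discs : 𝒟.Finite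
  genus_le : G ≤ T
  main_le : D ≤ T
  discs_le : ∀ D' ∈ 𝒟, D' ≤ T
  genus_surface : IsTriangulatedSurface G
  main_disc : IsTriangulatedDisc D
  discs_disc : ∀ D' ∈ 𝒟, IsTriangulatedDisc D'
  exists_maxValence : ∃ v ∈ interiorVertices D, IsMaxValenceVertex T v
  union_eq : G ⊔ D ⊔ sSup 𝒟 = T
  genus_inf_main : IsCircle (G ⊓ D) ∨ G ⊓ D = ⊥
  genus_inf_discs : ∀ D' ∈ 𝒟, IsCircle (G ⊓ D') ∨ G ⊓ D' = ⊥
  main_inf_discs : ∀ D' ∈ 𝒟, IsCircle (D ⊓ D') ∨ D ⊓ D' = ⊥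
  discs_inf_discs : 𝒟.Pairwise fun D' D'' => IsCircle (D' ⊓ D'') ∨ D' ⊓ D'' = ⊥

/-- A decomposition is minimal if the number of triangles of its genus-surface is minimal among
all decompositions of `T`. -/
structure IsMinimalDecomposition (T G D : PreAbstractSimplicialComplex V)
    (𝒟 : Set (PreAbstractSimplicialComplex V)) : Prop where
  decomposition : IsDecomposition T G D 𝒟
  minimal : ∀ G' D' 𝒟', IsDecomposition T G' D' 𝒟' → numTriangles G ≤ numTriangles G'

end TriSurf

/-!
The argument counts vertices and Euler characteristics. The topological input is the inequality
`χ(X) ≤ 1` for a connected subcomplex `X` of a closed surface `T` which misses some triangle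
(`eulerChar_le_one`): `T` is strongly connected (`triangleSet_subset`), so each nonempty set of
triangles of `X` has an edge lying in only one of them, and removing such triangles and edges in
turn leaves a connected graph. Deleting one triangle from `T` gives `χ(T) ≤ 2`.

Two discs of a decomposition meeting in a circle would have a union of Euler characteristic two, so
the union would contain the triangles of the genus-surface, which is absurd; hence the discs are
pairwise disjoint (`inf_eq_bot`). The main disc contains the closed star of a vertex of maximal
valence `M`, so it has at least `M + 1` vertices. By double counting, `χ(T) ≤ 2` and `M ≤ 4` force
`T` to have at most six vertices.

If there were two further discs, with at least three vertices each, then `M + 7 ≤ 11`, hence `M ≤ 4`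
and `T` would have at most six vertices, against `M + 7 ≥ 10`. If there is one further disc and it
has an interior vertex, it has at least five vertices: with four it would be the star of a 3-valent
vertex, and as `T` is a root it would be the boundary of a tetrahedron (`numVertices_le_four`). So
`M + 6 ≤ 11`, and excluding `M ≤ 4` as before leaves `M = 5` and eleven vertices, whence `χ(T) = 2`.
Then a triangle of the further disc and its complement form a decomposition
(`isDecomposition_simplex_deletion`), so by minimality the genus-surface has only one triangle. That
triangle would have an edge in each of the two disjoint discs (`one_lt_numTriangles`), but two edges
of a triangle share a vertex.
-/

namespace TriSurf

/-! ### Faces, links and graphs -/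

section Basic

variable {V : Type*} {K L : PreAbstractSimplicialComplex V} {u v w : V} {s t e : Finset V}

theorem mem_faces_of_subset (ht : t ∈ K.faces) (hst : s ⊆ t) (hs : s.Nonempty) : s ∈ K.faces :=
  (K.isRelLowerSet_faces ht).2 hst hs

theorem mem_vertexSet_of_mem (ht : t ∈ K.faces) (hv : v ∈ t) : v ∈ vertexSet K :=
  mem_faces_of_subset ht (by simpa using hv) (by simp)

theorem vertexSet_mono (h : K ≤ L) : vertexSet K ⊆ vertexSet L := fun _ hv => h hv

theorem edgeSet_mono (h : K ≤ L) : edgeSet K ⊆ edgeSet L := fun _ he => ⟨h he.1, he.2⟩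

theorem triangleSet_mono (h : K ≤ L) : triangleSet K ⊆ triangleSet L :=
  fun _ ht => ⟨h ht.1, ht.2⟩

theorem vertexSet_link_subset : vertexSet (link K v) ⊆ vertexSet K := fun _ hw => hw.1

theorem finite_vertexSet (h : K.faces.Finite) : (vertexSet K).Finite :=
  h.preimage (Finset.singleton_injective.injOn)

theorem finite_edgeSet (h : K.faces.Finite) : (edgeSet K).Finite := h.subset fun _ he => he.1

theorem finite_triangleSet (h : K.faces.Finite) : (triangleSet K).Finite :=
  h.subset fun _ he => he.1

theorem reachable_induction {G : SimpleGraph V} {P : V → Prop} (hu : P u)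
    (hP : ∀ a b, G.Adj a b → P a → P b) (h : G.Reachable u v) : P v := by
  rw [SimpleGraph.reachable_iff_reflTransGen] at h
  induction h with
  | refl => exact hu
  | tail _ hab ih => exact hP _ _ hab ih

theorem reachable_of_forall_adj {G H : SimpleGraph V} (hGH : ∀ a b, G.Adj a b → H.Reachable a b)
    (h : G.Reachable u v) : H.Reachable u v :=
  reachable_induction (P := H.Reachable u) .rfl (fun a b hab hu => hu.trans (hGH a b hab)) h

variable [DecidableEq V]

theorem eq_pair_of_mem (he : e.card = 2) (hu : u ∈ e) (hv : v ∈ e) (huv : u ≠ v) :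
    e = {u, v} := by
  refine (Finset.eq_of_subset_of_card_le ?_ ?_).symm
  · intro x; grind
  · rw [he, Finset.card_pair huv]

theorem skeletonGraph_adj : (skeletonGraph K).Adj u v ↔ u ≠ v ∧ {u, v} ∈ K.faces := by
  constructor
  · rintro ⟨e, ⟨he, hc⟩, hu, hv, huv⟩
    exact ⟨huv, eq_pair_of_mem hc hu hv huv ▸ he⟩
  · rintro ⟨huv, h⟩
    exact ⟨_, ⟨h, Finset.card_pair huv⟩, by simp, by simp, huv⟩

theorem mem_link_faces :
    s ∈ (link K v).faces ↔ s.Nonempty ∧ v ∉ s ∧ insert v s ∈ K.faces := by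
  constructor
  · rintro ⟨hs, hv, t, ht, hvt, hst⟩
    exact ⟨(K.isRelLowerSet_faces hs).1, hv,
      mem_faces_of_subset ht (Finset.insert_subset hvt hst) (by simp)⟩
  · rintro ⟨hs, hv, h⟩
    exact ⟨mem_faces_of_subset h (Finset.subset_insert _ _) hs, hv, _, h, by simp,
      Finset.subset_insert _ _⟩

theorem mem_vertexSet_link : w ∈ vertexSet (link K v) ↔ v ≠ w ∧ {v, w} ∈ K.faces := by
  simp [vertexSet, mem_link_faces]

theorem link_mono (h : K ≤ L) : link K v ≤ link L v := by
  intro s hs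
  have := mem_link_faces.1 hs
  exact mem_link_faces.2 ⟨this.1, this.2.1, h this.2.2⟩

theorem numEdges_link : numEdges (link K v) = valence K v := by
  have : (insert v '' edgeSet (link K v)) = {s | s ∈ triangleSet K ∧ v ∈ s} := by
    ext t
    constructor
    · rintro ⟨e, ⟨he, hc⟩, rfl⟩
      obtain ⟨_, hv, h⟩ := mem_link_faces.1 he
      exact ⟨⟨h, by rw [Finset.card_insert_of_notMem hv, hc]⟩, by simp⟩
    · rintro ⟨⟨ht, hc⟩, hv⟩
      have hc' : (t.erase v).card = 2 := by rw [Finset.card_erase_of_mem hv, hc]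
      refine ⟨t.erase v, ⟨mem_link_faces.2 ⟨?_, by simp, ?_⟩, hc'⟩, Finset.insert_erase hv⟩
      · exact Finset.card_pos.1 (by omega)
      · rwa [Finset.insert_erase hv]
  rw [valence, ← this, Set.InjOn.ncard_image, numEdges]
  intro e he f hf hef
  have h1 := (mem_link_faces.1 he.1).2.1
  have h2 := (mem_link_faces.1 hf.1).2.1
  simpa [h1, h2] using congrArg (Finset.erase · v) hef

/-- The edges of the link of `v` at `w` correspond to the triangles on the edge `{v, w}`. -/
theorem numEdgesAt_link (hvw : v ≠ w) :
    numEdgesAt (link K v) w = {t | t ∈ triangleSet K ∧ {v, w} ⊆ t}.ncard := by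
  have : (insert v '' {e | e ∈ edgeSet (link K v) ∧ w ∈ e}) =
      {t | t ∈ triangleSet K ∧ {v, w} ⊆ t} := by
    ext t
    constructor
    · rintro ⟨e, ⟨⟨he, hc⟩, hw⟩, rfl⟩
      obtain ⟨_, hv, h⟩ := mem_link_faces.1 he
      exact ⟨⟨h, by rw [Finset.card_insert_of_notMem hv, hc]⟩, by grind⟩
    · rintro ⟨⟨ht, hc⟩, hs⟩
      have hv : v ∈ t := hs (by simp)
      have hw : w ∈ t := hs (by simp)
      have hc' : (t.erase v).card = 2 := by rw [Finset.card_erase_of_mem hv, hc]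
      refine ⟨t.erase v, ⟨⟨mem_link_faces.2 ⟨?_, by simp, ?_⟩, hc'⟩, by grind⟩,
        Finset.insert_erase hv⟩
      · exact Finset.card_pos.1 (by omega)
      · rwa [Finset.insert_erase hv]
  rw [← this, Set.InjOn.ncard_image, numEdgesAt]
  intro e he f hf hef
  have h1 := (mem_link_faces.1 he.1.1).2.1
  have h2 := (mem_link_faces.1 hf.1.1).2.1
  simpa [h1, h2] using congrArg (Finset.erase · v) hef

end Basic

/-! ### Double counting -/

section Counting

variable {V : Type*} {K L C : PreAbstractSimplicialComplex V} {v w : V} {s t e : Finset V}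

theorem ncard_mul_le_ncard_mul {α β : Type*} {A : Set α} {B : Set β} (hA : A.Finite)
    (hB : B.Finite) (r : α → β → Prop) {m n : ℕ} (hm : ∀ a ∈ A, m ≤ {b | b ∈ B ∧ r a b}.ncard)
    (hn : ∀ b ∈ B, {a | a ∈ A ∧ r a b}.ncard ≤ n) : A.ncard * m ≤ B.ncard * n := by
  classical
  lift A to Finset α using hA
  lift B to Finset β using hB
  rw [Set.ncard_coe_finset, Set.ncard_coe_finset]
  refine Finset.card_mul_le_card_mul r (fun a ha => (hm a ha).trans_eq ?_)
    fun b hb => Eq.trans_le ?_ (hn b hb)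
  · rw [← Set.ncard_coe_finset]; congr 1; ext; simp
  · rw [← Set.ncard_coe_finset]; congr 1; ext; simp

theorem ncard_mul_eq_ncard_mul {α β : Type*} {A : Set α} {B : Set β} (hA : A.Finite)
    (hB : B.Finite) (r : α → β → Prop) {m n : ℕ} (hm : ∀ a ∈ A, {b | b ∈ B ∧ r a b}.ncard = m)
    (hn : ∀ b ∈ B, {a | a ∈ A ∧ r a b}.ncard = n) : A.ncard * m = B.ncard * n :=
  le_antisymm (ncard_mul_le_ncard_mul hA hB r (fun a ha => (hm a ha).ge) fun b hb => (hn b hb).le)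
    (ncard_mul_le_ncard_mul hB hA (fun b a => r a b) (fun b hb => (hn b hb).ge)
      fun a ha => (hm a ha).le)

theorem ncard_vertexSet_inter (ht : t ∈ K.faces) :
    {v | v ∈ vertexSet K ∧ v ∈ t}.ncard = t.card := by
  rw [← Set.ncard_coe_finset]
  congr 1
  ext v
  simpa using fun hv => mem_vertexSet_of_mem ht hv

theorem IsCircle.numVertices_eq (h : IsCircle C) : numVertices C = numEdges C := by
  have := ncard_mul_eq_ncard_mul (finite_vertexSet h.finite) (finite_edgeSet h.finite)
    (fun v e => v ∈ e) (m := 2) (n := 2) (fun v hv => h.two_edges v hv)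
    fun e he => (ncard_vertexSet_inter he.1).trans he.2
  rw [numVertices, numEdges]
  omega

theorem IsCircle.eulerChar_eq_zero (h : IsCircle C) : eulerChar C = 0 := by
  have h0 : numTriangles C = 0 := by
    rw [numTriangles, Set.ncard_eq_zero (finite_triangleSet h.finite)]
    ext t
    simpa [triangleSet] using fun ht => (lt_of_le_of_lt (h.card_le t ht) (by norm_num)).ne
  rw [eulerChar, h.numVertices_eq, h0]
  simp

theorem IsCircle.three_le_numVertices (h : IsCircle C) : 3 ≤ numVertices C := by
  classical
  obtain ⟨v, hv⟩ := h.connected.1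
  obtain ⟨e, f, hef, hs⟩ := Set.ncard_eq_two.1 (h.two_edges v hv)
  have he : e ∈ {e | e ∈ edgeSet C ∧ v ∈ e} := by rw [hs]; simp
  have hf : f ∈ {e | e ∈ edgeSet C ∧ v ∈ e} := by rw [hs]; simp
  have hlt : e.card < (e ∪ f).card := by
    refine Finset.card_lt_card (Finset.ssubset_iff_subset_ne.2 ⟨Finset.subset_union_left, ?_⟩)
    intro heq
    have hfe : f ⊆ e := heq ▸ Finset.subset_union_right
    exact hef (Finset.eq_of_subset_of_card_le hfe (by rw [he.1.2, hf.1.2])).symm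
  rw [he.1.2] at hlt
  refine le_trans hlt ?_
  rw [← Set.ncard_coe_finset]
  refine Set.ncard_le_ncard (fun x hx => ?_) (finite_vertexSet h.finite)
  rcases Finset.mem_union.1 (Finset.mem_coe.1 hx) with hx | hx
  · exact mem_vertexSet_of_mem he.1.1 hx
  · exact mem_vertexSet_of_mem hf.1.1 hx

/-- A circle contained in another circle has all its vertices. -/
theorem IsCircle.vertexSet_subset_of_le (hC : IsCircle C) (hK : IsCircle K) (hle : C ≤ K) :
    vertexSet K ⊆ vertexSet C := by
  classical
  obtain ⟨a, ha⟩ := hC.connected.1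
  intro b hb
  refine reachable_induction (P := (· ∈ vertexSet C)) ha (fun x y hxy hx => ?_)
    (hK.connected.2 a (vertexSet_mono hle ha) b hb)
  obtain ⟨hne, hmem⟩ := skeletonGraph_adj.1 hxy
  -- both circles have exactly two edges at `x`, so they have the same ones
  have heq : {e | e ∈ edgeSet C ∧ x ∈ e} = {e | e ∈ edgeSet K ∧ x ∈ e} := by
    refine Set.eq_of_subset_of_ncard_le (fun e he => ⟨edgeSet_mono hle he.1, he.2⟩) ?_
      ((finite_edgeSet hK.finite).subset fun e he => he.1)
    exact ((hK.two_edges x (vertexSet_mono hle hx)).trans (hC.two_edges x hx).symm).le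
  have : {x, y} ∈ {e | e ∈ edgeSet C ∧ x ∈ e} := by
    rw [heq]; exact ⟨⟨hmem, Finset.card_pair hne⟩, by simp⟩
  exact mem_vertexSet_of_mem this.1.1 (by simp)

theorem eulerChar_sup_add_eulerChar_inf (hK : K.faces.Finite) (hL : L.faces.Finite) :
    eulerChar (K ⊔ L) + eulerChar (K ⊓ L) = eulerChar K + eulerChar L := by
  have hv := Set.ncard_union_add_ncard_inter (vertexSet K) (vertexSet L) (finite_vertexSet hK)
    (finite_vertexSet hL)
  have he := Set.ncard_union_add_ncard_inter (edgeSet K) (edgeSet L) (finite_edgeSet hK)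
    (finite_edgeSet hL)
  have ht := Set.ncard_union_add_ncard_inter (triangleSet K) (triangleSet L)
    (finite_triangleSet hK) (finite_triangleSet hL)
  have e1 : vertexSet (K ⊔ L) = vertexSet K ∪ vertexSet L := rfl
  have e2 : vertexSet (K ⊓ L) = vertexSet K ∩ vertexSet L := rfl
  have e3 : edgeSet (K ⊔ L) = edgeSet K ∪ edgeSet L := by
    ext e; exact or_and_right
  have e4 : edgeSet (K ⊓ L) = edgeSet K ∩ edgeSet L := by
    ext e; exact and_and_right
  have e5 : triangleSet (K ⊔ L) = triangleSet K ∪ triangleSet L := by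
    ext e; exact or_and_right
  have e6 : triangleSet (K ⊓ L) = triangleSet K ∩ triangleSet L := by
    ext e; exact and_and_right
  simp only [eulerChar, numVertices, numEdges, numTriangles, e1, e2, e3, e4, e5, e6]
  omega

theorem IsConnectedComplex.sup (hK : IsConnectedComplex K) (hL : IsConnectedComplex L)
    (hv : v ∈ vertexSet (K ⊓ L)) : IsConnectedComplex (K ⊔ L) := by
  classical
  have hKr : ∀ u ∈ vertexSet (K ⊔ L), (skeletonGraph (K ⊔ L)).Reachable u v := by
    rintro u (hu | hu)
    · exact reachable_of_forall_adj (fun a b hab => SimpleGraph.Adj.reachable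
        (skeletonGraph_adj.2 ⟨hab.ne, Or.inl (skeletonGraph_adj.1 hab).2⟩)) (hK.2 u hu v hv.1)
    · exact reachable_of_forall_adj (fun a b hab => SimpleGraph.Adj.reachable
        (skeletonGraph_adj.2 ⟨hab.ne, Or.inr (skeletonGraph_adj.1 hab).2⟩)) (hL.2 u hu v hv.2)
  exact ⟨⟨v, Or.inl hv.1⟩, fun a ha b hb => (hKr a ha).trans (hKr b hb).symm⟩

end Counting

/-! ### Collapsing -/

section Collapse

variable {V : Type*}

/-- The graph in which two points are adjacent if they are distinct and a member of `E` contains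
both. For `E = edgeSet K` this is `skeletonGraph K` by definition. -/
def edgeGraph (E : Set (Finset V)) : SimpleGraph V where
  Adj u v := ∃ e ∈ E, u ∈ e ∧ v ∈ e ∧ u ≠ v
  symm := ⟨fun _ _ ⟨e, he, hu, hv, hne⟩ => ⟨e, he, hv, hu, hne.symm⟩⟩
  loopless := ⟨fun _ ⟨_, _, _, _, hne⟩ => hne rfl⟩

/-- A connected graph has at most one vertex more than edges: each vertex other than a base point
selects an edge towards the base point. -/
theorem card_le_card_edges_add_one (A : Finset V) (E : Finset (Finset V))
    (hE : ∀ e ∈ E, e.card = 2) (hconn : ∀ u ∈ A, ∀ v ∈ A, (edgeGraph (E : Set _)).Reachable u v) :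
    A.card ≤ E.card + 1 := by
  classical
  rcases A.eq_empty_or_nonempty with rfl | ⟨a, ha⟩
  · simp
  set G := edgeGraph (E : Set (Finset V))
  have key : ∀ v ∈ A.erase a, ∃ p, {v, p} ∈ E ∧ G.dist p a < G.dist v a := by
    intro v hv
    obtain ⟨hva, hvA⟩ := Finset.mem_erase.1 hv
    obtain ⟨q, hq⟩ := (hconn v hvA a ha).exists_walk_length_eq_dist
    cases q with
    | nil => exact absurd rfl hva
    | @cons _ p _ hvp q =>
      refine ⟨p, ?_, ?_⟩
      · obtain ⟨e, he, h1, h2, h3⟩ := hvp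
        rwa [← eq_pair_of_mem (hE e he) h1 h2 h3]
      · rw [← hq, SimpleGraph.Walk.length_cons]
        exact Nat.lt_succ_of_le (SimpleGraph.dist_le q)
  choose! p hpE hpd using key
  have hle : (A.erase a).card ≤ E.card := by
    refine Finset.card_le_card_of_injOn (fun v => {v, p v}) hpE ?_
    intro v hv w hw hvw
    by_contra hne
    have h1 : v ∈ ({w, p w} : Finset V) := by
      rw [← show ({v, p v} : Finset V) = {w, p w} from hvw]; simp
    have h2 : w ∈ ({v, p v} : Finset V) := by
      rw [show ({v, p v} : Finset V) = {w, p w} from hvw]; simp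
    have h1 : v = p w := by simpa [hne] using h1
    have h2 : w = p v := by simpa [Ne.symm hne] using h2
    have h3 := hpd v hv
    have h4 := hpd w hw
    rw [← h2] at h3
    rw [← h1] at h4
    omega
  rw [Finset.card_erase_of_mem ha] at hle
  omega

/-- The Euler characteristic of a connected collapsible family of triangles is at most one.
Collapsibility is expressed by the presence of a free edge in every nonempty subfamily; removing a
triangle together with a free edge preserves connectedness, as the endpoints of the edge remain
joined through the third vertex. -/
theorem card_add_card_le_of_collapsible (A : Finset V) (n : ℕ) :
    ∀ (E F : Finset (Finset V)), F.card = n → (∀ e ∈ E, e.card = 2) → (∀ t ∈ F, t.card = 3) →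
      (∀ t ∈ F, ∀ e ⊆ t, e.card = 2 → e ∈ E) →
      (∀ B ⊆ F, B.Nonempty → ∃ t ∈ B, ∃ e ∈ E, e ⊆ t ∧ ∀ t' ∈ B, e ⊆ t' → t' = t) →
      (∀ u ∈ A, ∀ v ∈ A, (edgeGraph (E : Set _)).Reachable u v) →
      A.card + F.card ≤ E.card + 1 := by
  classical
  induction n with
  | zero =>
    intro E F hF hE _ _ _ hconn
    have := card_le_card_edges_add_one A E hE hconn
    omega
  | succ n ih =>
    intro E F hF hE hF3 hsub hfree hconn
    obtain ⟨t, ht, e, he, het, huniq⟩ := hfree F subset_rfl (Finset.card_pos.1 (by omega))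
    have hFc : (F.erase t).card = n := by rw [Finset.card_erase_of_mem ht]; omega
    have hne : ∀ t' ∈ F.erase t, ¬ e ⊆ t' := fun t' ht' h =>
      (Finset.mem_erase.1 ht').1 (huniq t' (Finset.mem_erase.1 ht').2 h)
    have := ih (E.erase e) (F.erase t) hFc (fun f hf => hE f (Finset.mem_of_mem_erase hf))
      (fun f hf => hF3 f (Finset.mem_of_mem_erase hf))
      (fun t' ht' f hf hfc => Finset.mem_erase.2
        ⟨fun h => hne t' ht' (h ▸ hf), hsub t' (Finset.mem_of_mem_erase ht') f hf hfc⟩)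
      (fun B hB hBne => by
        obtain ⟨t', ht', f, hf, hft, hu⟩ := hfree B (hB.trans (Finset.erase_subset _ _)) hBne
        exact ⟨t', ht', f, Finset.mem_erase.2 ⟨fun h => hne t' (hB ht') (h ▸ hft), hf⟩, hft, hu⟩)
      (fun u hu v hv => by
        refine reachable_of_forall_adj (fun a b hab => ?_) (hconn u hu v hv)
        obtain ⟨f, hf, haf, hbf, hab⟩ := hab
        by_cases hfe : f = e
        · subst hfe
          obtain ⟨c, hct, hcf⟩ : ∃ c ∈ t, c ∉ f := by
            refine Finset.exists_mem_notMem_of_card_lt_card ?_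
            rw [hE f hf, hF3 t ht]; norm_num
          have hac : a ≠ c := fun h => hcf (h ▸ haf)
          have hbc : b ≠ c := fun h => hcf (h ▸ hbf)
          have aux : ∀ x ∈ f, x ≠ c → (edgeGraph ((E.erase f : Finset _) : Set _)).Adj x c := by
            intro x hx hxc
            refine ⟨{x, c}, ?_, by simp, by simp, hxc⟩
            refine Finset.mem_coe.2 (Finset.mem_erase.2 ⟨fun h => hcf (h ▸ by simp), ?_⟩)
            refine hsub t ht _ ?_ (Finset.card_pair hxc)
            intro y hy
            rcases Finset.mem_insert.1 hy with rfl | hy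
            · exact het hx
            · rwa [Finset.mem_singleton.1 hy]
          exact (aux a haf hac).reachable.trans (aux b hbf hbc).reachable.symm
        · exact SimpleGraph.Adj.reachable
            ⟨f, Finset.mem_coe.2 (Finset.mem_erase.2 ⟨hfe, hf⟩), haf, hbf, hab⟩)
    rw [Finset.card_erase_of_mem ht, Finset.card_erase_of_mem he] at this
    have := Finset.card_pos.2 ⟨e, he⟩
    omega

end Collapse

/-! ### Closed surfaces -/

section Surface

variable {V : Type*} {T K X Y : PreAbstractSimplicialComplex V} {v w : V} {s t e : Finset V}

theorem IsTriangulatedSurface.exists_edge_link (h : IsTriangulatedSurface K)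
    (hw : w ∈ vertexSet (link K v)) (hv : v ∈ vertexSet K) :
    ∃ e ∈ edgeSet (link K v), w ∈ e := by
  have hpos : numEdgesAt (link K v) w ≠ 0 := by
    rcases h.link_circle_or_interval v hv with hc | hi
    · rw [hc.two_edges w hw]; norm_num
    · rcases hi.one_or_two_edges w hw with h1 | h1 <;> rw [h1] <;> norm_num
  obtain ⟨e, he, hwe⟩ := Set.nonempty_of_ncard_ne_zero hpos
  exact ⟨e, he, hwe⟩

theorem IsTriangulatedSurface.exists_triangle_of_edge [DecidableEq V]
    (h : IsTriangulatedSurface K) (hvw : v ≠ w) (he : {v, w} ∈ K.faces) :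
    ∃ t ∈ triangleSet K, v ∈ t ∧ w ∈ t := by
  obtain ⟨e, ⟨he, hc⟩, hwe⟩ := h.exists_edge_link (mem_vertexSet_link.2 ⟨hvw, he⟩)
    (mem_vertexSet_of_mem he (by simp))
  obtain ⟨_, hv, h⟩ := mem_link_faces.1 he
  exact ⟨_, ⟨h, by rw [Finset.card_insert_of_notMem hv, hc]⟩, by simp,
    Finset.mem_insert_of_mem hwe⟩

theorem IsTriangulatedSurface.link_connected (h : IsTriangulatedSurface K)
    (hv : v ∈ vertexSet K) : IsConnectedComplex (link K v) := by
  rcases h.link_circle_or_interval v hv with hc | hi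
  exacts [hc.connected, hi.connected]

theorem IsTriangulatedSurface.exists_triangle (h : IsTriangulatedSurface K) :
    (triangleSet K).Nonempty := by
  classical
  obtain ⟨v, hv⟩ := h.connected.1
  obtain ⟨w, hw⟩ := (h.link_connected hv).1
  obtain ⟨hvw, he⟩ := mem_vertexSet_link.1 hw
  obtain ⟨t, ht, -⟩ := h.exists_triangle_of_edge hvw he
  exact ⟨t, ht⟩

theorem card_le_numVertices (hK : K.faces.Finite) (ht : t ∈ K.faces) :
    t.card ≤ numVertices K := by
  rw [← Set.ncard_coe_finset]
  exact Set.ncard_le_ncard (fun v hv => mem_vertexSet_of_mem ht hv) (finite_vertexSet hK)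

theorem IsTriangulatedSurface.three_le_numVertices (h : IsTriangulatedSurface K) :
    3 ≤ numVertices K := by
  obtain ⟨t, ht⟩ := h.exists_triangle
  exact ht.2 ▸ card_le_numVertices h.finite ht.1

/-- Strong connectedness of a surface: a nonempty set of triangles which is closed under passing
to a neighbour across an edge contains all triangles. The links of the vertices are connected, so
all the triangles at a vertex belong to the set once one of them does. -/
theorem IsTriangulatedSurface.triangleSet_subset (h : IsTriangulatedSurface T)
    {A : Set (Finset V)} (hA : A ⊆ triangleSet T) (hne : A.Nonempty)
    (hcl : ∀ e ∈ edgeSet T, ∀ t ∈ A, ∀ t' ∈ triangleSet T, e ⊆ t → e ⊆ t' → t' ∈ A) :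
    triangleSet T ⊆ A := by
  classical
  have hedge : ∀ v w, v ≠ w → ∀ t ∈ A, v ∈ t → w ∈ t → ∀ t' ∈ triangleSet T, v ∈ t' →
      w ∈ t' → t' ∈ A := by
    intro v w hvw t ht hv hw t' ht' hv' hw'
    refine hcl {v, w} ⟨mem_faces_of_subset (hA ht).1 ?_ (by simp), Finset.card_pair hvw⟩ t ht t'
      ht' ?_ ?_ <;> grind
  have hother : ∀ t ∈ triangleSet T, ∀ v ∈ t, ∃ w ∈ t, v ≠ w := by
    intro t ht v hv
    obtain ⟨w, hw, hne⟩ := Finset.exists_mem_ne (by rw [ht.2]; norm_num : 1 < t.card) v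
    exact ⟨w, hw, hne.symm⟩
  have hvert : ∀ v, ∀ t ∈ A, v ∈ t → ∀ t' ∈ triangleSet T, v ∈ t' → t' ∈ A := by
    intro v t ht hv t' ht' hv'
    obtain ⟨a, hat, hva⟩ := hother t (hA ht) v hv
    obtain ⟨b, hbt, hvb⟩ := hother t' ht' v hv'
    have hlk : ∀ x, v ≠ x → ∀ s ∈ triangleSet T, v ∈ s → x ∈ s → x ∈ vertexSet (link T v) := by
      intro x hvx s hs hvs hxs
      exact mem_vertexSet_link.2 ⟨hvx, mem_faces_of_subset hs.1 (by grind) (by simp)⟩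
    have hr := (h.link_connected (mem_vertexSet_of_mem (hA ht).1 hv)).2 a
      (hlk a hva t (hA ht) hv hat) b (hlk b hvb t' ht' hv' hbt)
    refine reachable_induction
      (P := fun x => ∀ s ∈ triangleSet T, v ∈ s → x ∈ s → s ∈ A)
      (fun s hs hvs has => hedge v a hva t ht hv hat s hs hvs has) (fun x y hxy hx s hs hvs hys => ?_)
      hr t' ht' hv' hbt
    obtain ⟨hne, hxy⟩ := skeletonGraph_adj.1 hxy
    obtain ⟨-, hvn, hm⟩ := mem_link_faces.1 hxy
    have h3 : insert v {x, y} ∈ triangleSet T :=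
      ⟨hm, by rw [Finset.card_insert_of_notMem hvn, Finset.card_pair hne]⟩
    exact hedge v y (by grind) _ (hx _ h3 (by simp) (by simp)) (by simp) (by simp) s hs hvs hys
  obtain ⟨t, ht⟩ := hne
  intro t' ht'
  obtain ⟨u, hu⟩ : t.Nonempty := Finset.card_pos.1 (by rw [(hA ht).2]; norm_num)
  obtain ⟨u', hu'⟩ : t'.Nonempty := Finset.card_pos.1 (by rw [ht'.2]; norm_num)
  refine reachable_induction (P := fun x => ∀ s ∈ triangleSet T, x ∈ s → s ∈ A)
    (fun s hs hus => hvert u t ht hu s hs hus) (fun x y hxy hx s hs hys => ?_)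
    (h.connected.2 u (mem_vertexSet_of_mem (hA ht).1 hu) u' (mem_vertexSet_of_mem ht'.1 hu'))
    t' ht' hu'
  obtain ⟨hne, hxy⟩ := skeletonGraph_adj.1 hxy
  obtain ⟨r, hr, hxr, hyr⟩ := h.exists_triangle_of_edge hne hxy
  exact hvert y r (hx r hr hxr) hyr s hs hys

theorem IsClosedTriangulatedSurface.link_isCircle (h : IsClosedTriangulatedSurface T)
    (hv : v ∈ vertexSet T) : IsCircle (link T v) :=
  (h.surface.link_circle_or_interval v hv).resolve_right fun hi =>
    Set.notMem_empty v (h.boundary_empty ▸ ⟨hv, hi⟩)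

theorem IsClosedTriangulatedSurface.card_le (h : IsClosedTriangulatedSurface T)
    (hs : s ∈ T.faces) : s.card ≤ 3 := by
  classical
  obtain ⟨v, hv⟩ := (T.isRelLowerSet_faces hs).1
  have := Finset.card_erase_of_mem hv
  by_cases h0 : (s.erase v).Nonempty
  · have := (h.link_isCircle (mem_vertexSet_of_mem hs hv)).card_le (s.erase v)
      (mem_link_faces.2 ⟨h0, by simp, by rwa [Finset.insert_erase hv]⟩)
    omega
  · rw [Finset.not_nonempty_iff_eq_empty.1 h0] at this
    simp at this
    omega

theorem IsClosedTriangulatedSurface.ncard_triangles_of_edge (h : IsClosedTriangulatedSurface T)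
    (he : e ∈ edgeSet T) : {t | t ∈ triangleSet T ∧ e ⊆ t}.ncard = 2 := by
  classical
  obtain ⟨a, b, hab, rfl⟩ := Finset.card_eq_two.1 he.2
  rw [← numEdgesAt_link hab]
  exact (h.link_isCircle (mem_vertexSet_of_mem he.1 (by simp))).two_edges b
    (mem_vertexSet_link.2 ⟨hab, he.1⟩)

theorem IsClosedTriangulatedSurface.eq_or_eq_of_edge_subset (h : IsClosedTriangulatedSurface T)
    {t₁ t₂ t₃ : Finset V} (he : e ∈ edgeSet T) (h₁ : t₁ ∈ triangleSet T) (h₂ : t₂ ∈ triangleSet T)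
    (h₃ : t₃ ∈ triangleSet T) (e₁ : e ⊆ t₁) (e₂ : e ⊆ t₂) (e₃ : e ⊆ t₃) (hne : t₁ ≠ t₂) :
    t₃ = t₁ ∨ t₃ = t₂ := by
  obtain ⟨x, y, -, hxy⟩ := Set.ncard_eq_two.1 (h.ncard_triangles_of_edge he)
  have m : ∀ t, t ∈ triangleSet T → e ⊆ t → t = x ∨ t = y := by
    intro t ht het
    have : t ∈ {t | t ∈ triangleSet T ∧ e ⊆ t} := ⟨ht, het⟩
    rw [hxy] at this
    simpa using this
  have := m _ h₁ e₁
  have := m _ h₂ e₂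
  have := m _ h₃ e₃
  grind

theorem IsClosedTriangulatedSurface.numVertices_link (h : IsClosedTriangulatedSurface T)
    (hv : v ∈ vertexSet T) : numVertices (link T v) = valence T v := by
  classical
  rw [(h.link_isCircle hv).numVertices_eq, numEdges_link]

theorem IsClosedTriangulatedSurface.three_le_valence (h : IsClosedTriangulatedSurface T)
    (hv : v ∈ vertexSet T) : 3 ≤ valence T v :=
  h.numVertices_link hv ▸ (h.link_isCircle hv).three_le_numVertices

theorem IsClosedTriangulatedSurface.two_mul_numEdges (h : IsClosedTriangulatedSurface T) :
    numEdges T * 2 = numTriangles T * 3 := by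
  refine ncard_mul_eq_ncard_mul (finite_edgeSet h.surface.finite)
    (finite_triangleSet h.surface.finite) (fun e t => e ⊆ t)
    (fun e he => h.ncard_triangles_of_edge he) fun t ht => ?_
  have : {e | e ∈ edgeSet T ∧ e ⊆ t} = ↑(t.powersetCard 2) := by
    ext e
    rw [Finset.mem_coe, Finset.mem_powersetCard]
    constructor
    · rintro ⟨⟨_, hc⟩, hs⟩
      exact ⟨hs, hc⟩
    · intro he
      exact ⟨⟨mem_faces_of_subset ht.1 he.1 (Finset.card_pos.1 (by omega)), he.2⟩, he.1⟩
  rw [this, Set.ncard_coe_finset, Finset.card_powersetCard, ht.2]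
  rfl

theorem numTriangles_mul_three_le (hT : T.faces.Finite) {M : ℕ}
    (hM : ∀ v ∈ vertexSet T, valence T v ≤ M) : numTriangles T * 3 ≤ numVertices T * M :=
  ncard_mul_le_ncard_mul (finite_triangleSet hT) (finite_vertexSet hT) (fun t v => v ∈ t)
    (fun _ ht => ((ncard_vertexSet_inter ht.1).trans ht.2).ge) hM

/-! ### Bounds on the Euler characteristic -/

/-- A connected proper subcomplex of a closed surface, missing some triangle, has Euler
characteristic at most one: by strong connectedness each nonempty set of its triangles has an edge
whose other triangle lies outside the set, so the subcomplex collapses to a graph. -/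
theorem IsClosedTriangulatedSurface.eulerChar_le_one (h : IsClosedTriangulatedSurface T)
    (hX : X ≤ T) (hconn : IsConnectedComplex X) (hne : ¬ triangleSet T ⊆ triangleSet X) :
    eulerChar X ≤ 1 := by
  have hfin : X.faces.Finite := h.surface.finite.subset hX
  have hV := finite_vertexSet hfin
  have hE := finite_edgeSet hfin
  have hF := finite_triangleSet hfin
  have key := card_add_card_le_of_collapsible hV.toFinset _ hE.toFinset hF.toFinset rfl
    (fun e he => (hE.mem_toFinset.1 he).2) (fun t ht => (hF.mem_toFinset.1 ht).2)
    (fun t ht e he hc => hE.mem_toFinset.2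
      ⟨mem_faces_of_subset (hF.mem_toFinset.1 ht).1 he (Finset.card_pos.1 (by omega)), hc⟩)
    (fun B hB hBne => ?_)
    (fun u hu v hv => by
      rw [hE.coe_toFinset]
      exact hconn.2 u (hV.mem_toFinset.1 hu) v (hV.mem_toFinset.1 hv))
  · rw [← Set.ncard_eq_toFinset_card _ hV, ← Set.ncard_eq_toFinset_card _ hE,
      ← Set.ncard_eq_toFinset_card _ hF] at key
    simp only [eulerChar, numVertices, numEdges, numTriangles]
    omega
  · by_contra hcon
    push Not at hcon
    have hBX : ∀ t ∈ B, t ∈ triangleSet X := fun t ht => hF.mem_toFinset.1 (hB ht)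
    refine hne ((h.surface.triangleSet_subset (A := (B : Set (Finset V)))
      (fun t ht => triangleSet_mono hX (hBX t ht)) (by simpa using hBne) ?_).trans
      fun t ht => hBX t ht)
    intro e he t ht t' ht' het het'
    obtain ⟨r, hr, her, hrt⟩ := hcon t ht e (hE.mem_toFinset.2
      ⟨mem_faces_of_subset (hBX t ht).1 het (Finset.card_pos.1 (by rw [he.2]; norm_num)), he.2⟩)
      het
    rcases h.eq_or_eq_of_edge_subset he (triangleSet_mono hX (hBX r hr))
      (triangleSet_mono hX (hBX t ht)) ht' her het het' hrt with rfl | rfl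
    exacts [hr, ht]

/-- Two discs which meet in a circle would form a connected subcomplex of Euler characteristic
two, hence the whole surface. -/
theorem IsClosedTriangulatedSurface.inf_eq_bot (h : IsClosedTriangulatedSurface T)
    (hX : X ≤ T) (hY : Y ≤ T) (hXd : IsTriangulatedDisc X) (hYd : IsTriangulatedDisc Y)
    (hXY : IsCircle (X ⊓ Y) ∨ X ⊓ Y = ⊥) (ht : t ∈ triangleSet T) (htX : t ∉ X.faces)
    (htY : t ∉ Y.faces) : X ⊓ Y = ⊥ := by
  refine hXY.resolve_left fun hc => ?_
  obtain ⟨v, hv⟩ := hc.connected.1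
  have h1 := h.eulerChar_le_one (sup_le hX hY)
    (hXd.surface.connected.sup hYd.surface.connected hv)
    fun hs => (hs ht).1.elim htX htY
  have h2 := eulerChar_sup_add_eulerChar_inf hXd.surface.finite hYd.surface.finite
  rw [hc.eulerChar_eq_zero, hXd.euler, hYd.euler] at h2
  omega

/-! ### Deleting a triangle -/

/-- The largest subcomplex of `K` which does not contain the face `t`. -/
def deletion (K : PreAbstractSimplicialComplex V) (t : Finset V) :
    PreAbstractSimplicialComplex V where
  faces := {s | s ∈ K.faces ∧ ¬ t ⊆ s}
  isRelLowerSet_faces := by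
    rintro s ⟨hs, hts⟩
    exact ⟨(K.isRelLowerSet_faces hs).1, fun u hu hne =>
      ⟨(K.isRelLowerSet_faces hs).2 hu hne, fun h => hts (h.trans hu)⟩⟩

theorem deletion_le : deletion K t ≤ K := fun _ hs => hs.1

theorem mem_deletion_of_card_lt (hs : s ∈ K.faces) (hc : s.card < t.card) :
    s ∈ (deletion K t).faces :=
  ⟨hs, fun h => (Finset.card_le_card h).not_gt hc⟩

theorem vertexSet_deletion (ht : 2 ≤ t.card) : vertexSet (deletion K t) = vertexSet K :=
  (vertexSet_mono deletion_le).antisymm fun v hv =>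
    mem_deletion_of_card_lt hv (by rw [Finset.card_singleton]; omega)

theorem edgeSet_deletion (ht : 3 ≤ t.card) : edgeSet (deletion K t) = edgeSet K :=
  (edgeSet_mono deletion_le).antisymm fun _ he =>
    ⟨mem_deletion_of_card_lt he.1 (by rw [he.2]; omega), he.2⟩

theorem edgeSet_deletion_edge (ht : t.card = 2) : edgeSet (deletion K t) = edgeSet K \ {t} := by
  ext e
  constructor
  · rintro ⟨⟨he, hte⟩, hc⟩
    exact ⟨⟨he, hc⟩, fun h => hte (by rw [Set.mem_singleton_iff.1 h])⟩
  · rintro ⟨⟨he, hc⟩, hne⟩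
    exact ⟨⟨he, fun h => hne (Finset.eq_of_subset_of_card_le h (by omega)).symm⟩, hc⟩

theorem triangleSet_deletion (ht : t.card = 3) :
    triangleSet (deletion K t) = triangleSet K \ {t} := by
  ext e
  constructor
  · rintro ⟨⟨he, hte⟩, hc⟩
    exact ⟨⟨he, hc⟩, fun h => hte (by rw [Set.mem_singleton_iff.1 h])⟩
  · rintro ⟨⟨he, hc⟩, hne⟩
    exact ⟨⟨he, fun h => hne (Finset.eq_of_subset_of_card_le h (by omega)).symm⟩, hc⟩

theorem deletion_eq_self (h : ∀ s ∈ K.faces, s.card < t.card) : deletion K t = K :=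
  le_antisymm deletion_le fun s hs => mem_deletion_of_card_lt hs (h s hs)

theorem link_deletion [DecidableEq V] :
    link (deletion K t) v = deletion (link K v) (t.erase v) := by
  refine PreAbstractSimplicialComplex.ext (Set.ext fun s => ?_)
  change s ∈ (link (deletion K t) v).faces ↔ s ∈ (link K v).faces ∧ ¬ t.erase v ⊆ s
  rw [mem_link_faces, mem_link_faces, ← Finset.subset_insert_iff]
  exact ⟨fun ⟨a, b, c, d⟩ => ⟨⟨a, b, c⟩, d⟩, fun ⟨⟨a, b, c⟩, d⟩ => ⟨a, b, c, d⟩⟩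

theorem IsConnectedComplex.deletion (hK : IsConnectedComplex K) (ht : 3 ≤ t.card) :
    IsConnectedComplex (deletion K t) := by
  classical
  rw [IsConnectedComplex, vertexSet_deletion (by omega)]
  refine ⟨hK.1, fun u hu v hv => reachable_of_forall_adj (fun a b hab => ?_) (hK.2 u hu v hv)⟩
  obtain ⟨hne, hab⟩ := skeletonGraph_adj.1 hab
  exact SimpleGraph.Adj.reachable (skeletonGraph_adj.2
    ⟨hne, mem_deletion_of_card_lt hab (by rw [Finset.card_pair hne]; omega)⟩)

theorem eulerChar_deletion (hK : K.faces.Finite) (ht : t ∈ triangleSet K) :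
    eulerChar (deletion K t) = eulerChar K - 1 := by
  have h3 : numTriangles (deletion K t) + 1 = numTriangles K := by
    rw [numTriangles, triangleSet_deletion ht.2, numTriangles]
    exact Set.ncard_sdiff_singleton_add_one ht (finite_triangleSet hK)
  have h2 : 2 ≤ t.card := by rw [ht.2]; norm_num
  simp only [eulerChar, numVertices, numEdges, vertexSet_deletion (K := K) h2,
    edgeSet_deletion (K := K) ht.2.ge, ← h3]
  push_cast
  ring

theorem IsClosedTriangulatedSurface.eulerChar_le_two (h : IsClosedTriangulatedSurface T) :
    eulerChar T ≤ 2 := by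
  obtain ⟨t, ht⟩ := h.surface.exists_triangle
  have h1 := h.eulerChar_le_one deletion_le (h.surface.connected.deletion ht.2.ge)
    (fun hs => (hs ht).1.2 subset_rfl)
  rw [eulerChar_deletion h.surface.finite ht] at h1
  omega

theorem IsCircle.isInterval_deletion {C : PreAbstractSimplicialComplex V} (hC : IsCircle C)
    (he : e ∈ edgeSet C) : IsInterval (deletion C e) := by
  classical
  have hV : vertexSet (deletion C e) = vertexSet C := vertexSet_deletion he.2.ge
  have hset : ∀ v, {f | f ∈ edgeSet (deletion C e) ∧ v ∈ f} =
      {f | f ∈ edgeSet C ∧ v ∈ f} \ {e} := by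
    intro v
    rw [edgeSet_deletion_edge he.2]
    ext f
    exact and_right_comm
  have hone : ∀ v ∈ e, numEdgesAt (deletion C e) v = 1 := by
    intro v hv
    have h2 := hC.two_edges v (mem_vertexSet_of_mem he.1 hv)
    have := Set.ncard_sdiff_singleton_add_one (s := {f | f ∈ edgeSet C ∧ v ∈ f}) (a := e) ⟨he, hv⟩
      ((finite_edgeSet hC.finite).subset fun f hf => hf.1)
    rw [numEdgesAt] at h2
    rw [numEdgesAt, hset]
    omega
  have htwo : ∀ v ∈ vertexSet C, v ∉ e → numEdgesAt (deletion C e) v = 2 := by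
    intro v hv hve
    rw [numEdgesAt, hset, Set.sdiff_singleton_eq_self (fun h => hve h.2)]
    exact hC.two_edges v hv
  obtain ⟨a, b, hab, rfl⟩ := Finset.card_eq_two.1 he.2
  -- If `b` were not reachable from `a` without the edge `{a, b}`, the component `R` of `a` would
  -- contain an odd number of incidences with edges, against two for each of its vertices.
  have hreach : (skeletonGraph (deletion C {a, b})).Reachable a b := by
    by_contra hcon
    have hfV := finite_vertexSet hC.finite
    have hfE := finite_edgeSet hC.finite
    set R : Finset V := hfV.toFinset.filter fun x =>
      (skeletonGraph (deletion C {a, b})).Reachable a x with hR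
    have hmR : ∀ x, x ∈ R ↔ x ∈ vertexSet C ∧
        (skeletonGraph (deletion C {a, b})).Reachable a x := by
      intro x; rw [hR, Finset.mem_filter, hfV.mem_toFinset]
    have haR : a ∈ R := (hmR a).2 ⟨mem_vertexSet_of_mem he.1 (by simp), .rfl⟩
    have hbR : b ∉ R := fun h => hcon ((hmR b).1 h).2
    have hsum := Finset.sum_card_bipartiteAbove_eq_sum_card_bipartiteBelow (s := R)
      (t := hfE.toFinset) (fun x f => x ∈ f)
    have hl : ∀ x ∈ R, (Finset.bipartiteAbove (fun x f => x ∈ f) hfE.toFinset x).card = 2 := by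
      intro x hx
      rw [← hC.two_edges x ((hmR x).1 hx).1, numEdgesAt, ← Set.ncard_coe_finset]
      congr 1
      ext f
      simp [Finset.bipartiteAbove]
    rw [Finset.sum_congr rfl hl, ← Finset.add_sum_erase _ _ (hfE.mem_toFinset.2 he)] at hsum
    have h1 : (Finset.bipartiteBelow (fun x f => x ∈ f) R ({a, b} : Finset V)).card = 1 := by
      rw [Finset.card_eq_one]
      refine ⟨a, ?_⟩
      ext x
      simp only [Finset.bipartiteBelow, Finset.mem_filter, Finset.mem_singleton, Finset.mem_insert]
      constructor
      · rintro ⟨hx, rfl | rfl⟩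
        exacts [rfl, absurd hx hbR]
      · rintro rfl
        exact ⟨haR, Or.inl rfl⟩
    have h2 : 2 ∣ ∑ f ∈ hfE.toFinset.erase {a, b},
        (Finset.bipartiteBelow (fun x f => x ∈ f) R f).card := by
      refine Finset.dvd_sum fun f hf => ?_
      obtain ⟨hfne, hf⟩ := Finset.mem_erase.1 hf
      have hf := hfE.mem_toFinset.1 hf
      by_cases hx : ∃ x ∈ f, x ∈ R
      · obtain ⟨x, hxf, hxR⟩ := hx
        have : Finset.bipartiteBelow (fun x f => x ∈ f) R f = f := by
          ext y
          simp only [Finset.bipartiteBelow, Finset.mem_filter]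
          refine ⟨fun h => h.2, fun hy => ⟨(hmR y).2 ⟨mem_vertexSet_of_mem hf.1 hy, ?_⟩, hy⟩⟩
          by_cases hxy : x = y
          · exact hxy ▸ ((hmR x).1 hxR).2
          · refine ((hmR x).1 hxR).2.trans (SimpleGraph.Adj.reachable ⟨f, ?_, hxf, hy, hxy⟩)
            rw [edgeSet_deletion_edge he.2]
            exact ⟨hf, hfne⟩
        rw [this, hf.2]
      · have : Finset.bipartiteBelow (fun x f => x ∈ f) R f = ∅ := by
          ext y
          simp only [Finset.bipartiteBelow, Finset.mem_filter, Finset.notMem_empty, iff_false]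
          exact fun h => hx ⟨y, h.2, h.1⟩
        simp [this]
    rw [h1, Finset.sum_const, smul_eq_mul] at hsum
    omega
  refine ⟨hC.finite.subset deletion_le, fun s hs => hC.card_le s hs.1, ⟨hV ▸ hC.connected.1, ?_⟩,
    fun v hv => ?_, a, hV ▸ mem_vertexSet_of_mem he.1 (by simp), hone a (by simp)⟩
  · rw [hV]
    intro u hu v hv
    refine reachable_of_forall_adj (fun x y hxy => ?_) (hC.connected.2 u hu v hv)
    obtain ⟨f, hf, hx, hy, hne⟩ := hxy
    by_cases hfe : f = {a, b}
    · subst hfe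
      have : (x = a ∧ y = b) ∨ (x = b ∧ y = a) := by grind
      rcases this with ⟨rfl, rfl⟩ | ⟨rfl, rfl⟩
      exacts [hreach, hreach.symm]
    · refine SimpleGraph.Adj.reachable ⟨f, ?_, hx, hy, hne⟩
      rw [edgeSet_deletion_edge he.2]
      exact ⟨hf, hfe⟩
  · rw [hV] at hv
    by_cases hve : v ∈ ({a, b} : Finset V)
    · exact Or.inl (hone v hve)
    · exact Or.inr (htwo v hv hve)

end Surface

/-! ### Cutting a triangle out of a sphere -/

section Sphere

variable {V : Type*} {T K : PreAbstractSimplicialComplex V} {v w : V} {s t e : Finset V}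

/-- The complex of all nonempty subsets of `t`. -/
def simplex (t : Finset V) : PreAbstractSimplicialComplex V where
  faces := {s | s.Nonempty ∧ s ⊆ t}
  isRelLowerSet_faces := by
    rintro s ⟨hne, hs⟩
    exact ⟨hne, fun u hu hune => ⟨hune, hu.trans hs⟩⟩

theorem mem_vertexSet_simplex : v ∈ vertexSet (simplex t) ↔ v ∈ t := by
  simp [vertexSet, simplex]

theorem finite_simplex : (simplex t).faces.Finite :=
  t.powerset.finite_toSet.subset fun _ hs => Finset.mem_coe.2 (Finset.mem_powerset.2 hs.2)

theorem link_simplex [DecidableEq V] (hv : v ∈ t) :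
    link (simplex t) v = simplex (t.erase v) := by
  refine PreAbstractSimplicialComplex.ext (Set.ext fun s => ?_)
  rw [mem_link_faces]
  simp only [simplex, Set.mem_ofPred_eq, Finset.insert_nonempty, true_and,
    Finset.insert_subset_iff, hv, Finset.subset_erase]
  tauto

theorem isConnectedComplex_simplex (ht : t.Nonempty) : IsConnectedComplex (simplex t) := by
  classical
  obtain ⟨a, ha⟩ := ht
  refine ⟨⟨a, mem_vertexSet_simplex.2 ha⟩, fun u hu v hv => ?_⟩
  by_cases huv : u = v
  · exact huv ▸ .rfl
  · refine SimpleGraph.Adj.reachable (skeletonGraph_adj.2 ⟨huv, by simp, ?_⟩)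
    have := mem_vertexSet_simplex.1 hu
    have := mem_vertexSet_simplex.1 hv
    grind

theorem numEdgesAt_simplex (hv : v ∈ t) : numEdgesAt (simplex t) v + 1 = t.card := by
  classical
  have : (fun w => ({v, w} : Finset V)) '' ↑(t.erase v) =
      {e | e ∈ edgeSet (simplex t) ∧ v ∈ e} := by
    ext e
    constructor
    · rintro ⟨w, hw, rfl⟩
      have hw := Finset.mem_erase.1 (Finset.mem_coe.1 hw)
      exact ⟨⟨⟨by simp, by grind⟩, Finset.card_pair hw.1.symm⟩, by simp⟩
    · rintro ⟨⟨⟨_, hs⟩, hc⟩, hve⟩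
      obtain ⟨w, hw, hne⟩ := Finset.exists_mem_ne (by rw [hc]; norm_num : 1 < e.card) v
      exact ⟨w, Finset.mem_coe.2 (Finset.mem_erase.2 ⟨hne, hs hw⟩),
        (eq_pair_of_mem hc hve hw hne.symm).symm⟩
  rw [numEdgesAt, ← this, Set.InjOn.ncard_image, Set.ncard_coe_finset,
    Finset.card_erase_add_one hv]
  intro w hw w' hw' h
  have hw := Finset.mem_erase.1 (Finset.mem_coe.1 hw)
  have : w ∈ ({v, w'} : Finset V) := by rw [← show ({v, w} : Finset V) = {v, w'} from h]; simp
  simpa [hw.1] using this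

theorem isInterval_simplex (ht : t.card = 2) : IsInterval (simplex t) := by
  have h1 : ∀ v ∈ vertexSet (simplex t), numEdgesAt (simplex t) v = 1 := by
    intro v hv
    have := numEdgesAt_simplex (mem_vertexSet_simplex.1 hv)
    omega
  have hc := isConnectedComplex_simplex (Finset.card_pos.1 (by omega : 0 < t.card))
  obtain ⟨a, ha⟩ := hc.1
  exact ⟨finite_simplex, fun s hs => ht ▸ Finset.card_le_card hs.2, hc,
    fun v hv => Or.inl (h1 v hv), a, ha, h1 a ha⟩

theorem isTriangulatedSurface_simplex (ht : t.card = 3) :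
    IsTriangulatedSurface (simplex t) := by
  classical
  refine ⟨finite_simplex, isConnectedComplex_simplex (Finset.card_pos.1 (by omega)),
    fun v hv => Or.inr ?_⟩
  have hv := mem_vertexSet_simplex.1 hv
  rw [link_simplex hv]
  exact isInterval_simplex (by rw [Finset.card_erase_of_mem hv, ht])

theorem isCircle_boundary_simplex (ht : t.card = 3) : IsCircle (deletion (simplex t) t) := by
  refine ⟨finite_simplex.subset deletion_le, fun s hs => ?_,
    (isConnectedComplex_simplex (Finset.card_pos.1 (by omega))).deletion ht.ge, fun v hv => ?_⟩
  · have := Finset.card_lt_card (ssubset_of_subset_not_subset hs.1.2 hs.2)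
    omega
  · have := numEdgesAt_simplex (mem_vertexSet_simplex.1 (vertexSet_mono deletion_le hv))
    rw [numEdgesAt, edgeSet_deletion ht.ge]
    rw [numEdgesAt] at this
    omega

theorem IsClosedTriangulatedSurface.link_deletion_of_notMem
    (h : IsClosedTriangulatedSurface T) (ht : t ∈ triangleSet T) (hv : v ∈ vertexSet T)
    (hvt : v ∉ t) : link (deletion T t) v = link T v := by
  classical
  rw [link_deletion, Finset.erase_eq_of_notMem hvt]
  refine deletion_eq_self fun s hs => ?_
  rw [ht.2]
  exact Nat.lt_succ_of_le ((h.link_isCircle hv).card_le s hs)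

theorem IsClosedTriangulatedSurface.isInterval_link_deletion
    (h : IsClosedTriangulatedSurface T) (ht : t ∈ triangleSet T) (hvt : v ∈ t) :
    IsInterval (link (deletion T t) v) := by
  classical
  have hc : (t.erase v).card = 2 := by rw [Finset.card_erase_of_mem hvt, ht.2]
  rw [link_deletion]
  refine (h.link_isCircle (mem_vertexSet_of_mem ht.1 hvt)).isInterval_deletion
    ⟨mem_link_faces.2 ⟨Finset.card_pos.1 (by omega), by simp, ?_⟩, hc⟩
  rw [Finset.insert_erase hvt]
  exact ht.1

theorem IsClosedTriangulatedSurface.isTriangulatedDisc_deletion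
    (h : IsClosedTriangulatedSurface T) (hχ : eulerChar T = 2) (ht : t ∈ triangleSet T) :
    IsTriangulatedDisc (deletion T t) := by
  have hV : vertexSet (deletion T t) = vertexSet T :=
    vertexSet_deletion (by rw [ht.2]; norm_num)
  refine ⟨⟨h.surface.finite.subset deletion_le, h.surface.connected.deletion ht.2.ge,
    fun v hv => ?_⟩, ?_, ?_⟩
  · by_cases hvt : v ∈ t
    · exact Or.inr (h.isInterval_link_deletion ht hvt)
    · rw [hV] at hv
      exact Or.inl (h.link_deletion_of_notMem ht hv hvt ▸ h.link_isCircle hv)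
  · obtain ⟨v, hv⟩ : t.Nonempty := Finset.card_pos.1 (by rw [ht.2]; norm_num)
    exact ⟨v, hV ▸ mem_vertexSet_of_mem ht.1 hv, h.isInterval_link_deletion ht hv⟩
  · rw [eulerChar_deletion h.surface.finite ht, hχ]
    norm_num

/-- A triangle of a sphere and its complementary disc form a decomposition, provided that the
triangle avoids some vertex of maximal valence. -/
theorem IsClosedTriangulatedSurface.isDecomposition_simplex_deletion
    (h : IsClosedTriangulatedSurface T) (hχ : eulerChar T = 2) (ht : t ∈ triangleSet T)
    (hv : IsMaxValenceVertex T v) (hvt : v ∉ t) :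
    IsDecomposition T (simplex t) (deletion T t) ∅ where
  finite_discs := Set.finite_empty
  genus_le := fun _ hs => mem_faces_of_subset ht.1 hs.2 hs.1
  main_le := deletion_le
  discs_le := by simp
  genus_surface := isTriangulatedSurface_simplex ht.2
  main_disc := h.isTriangulatedDisc_deletion hχ ht
  discs_disc := by simp
  exists_maxValence := by
    refine ⟨v, ⟨?_, ?_⟩, hv⟩
    · rw [vertexSet_deletion (by rw [ht.2]; norm_num)]
      exact hv.1
    · rw [h.link_deletion_of_notMem ht hv.1 hvt]
      exact h.link_isCircle hv.1
  union_eq := by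
    rw [sSup_empty, sup_bot_eq]
    refine le_antisymm (sup_le (fun _ hs => mem_faces_of_subset ht.1 hs.2 hs.1) deletion_le)
      fun s hs => ?_
    by_cases hts : t ⊆ s
    · have hst : t = s :=
        Finset.eq_of_subset_of_card_le hts ((h.card_le hs).trans ht.2.ge)
      exact Or.inl ⟨(T.isRelLowerSet_faces hs).1, hst.ge⟩
    · exact Or.inr ⟨hs, hts⟩
  genus_inf_main := by
    refine Or.inl ?_
    convert isCircle_boundary_simplex ht.2 using 1
    refine PreAbstractSimplicialComplex.ext (Set.ext fun s => ?_)
    exact ⟨fun hs => ⟨hs.1, hs.2.2⟩,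
      fun hs => ⟨hs.1, mem_faces_of_subset ht.1 hs.1.2 hs.1.1, hs.2⟩⟩
  genus_inf_discs := by simp
  main_inf_discs := by simp
  discs_inf_discs := by simp

end Sphere

/-! ### Valences and the number of vertices -/

section Valence

variable {V : Type*} {T D X Y Z : PreAbstractSimplicialComplex V} {v w : V} {s t e : Finset V}

/-- A subcomplex contains the whole link of each of its interior vertices. -/
theorem IsClosedTriangulatedSurface.vertexSet_link_subset_of_mem_interior
    (h : IsClosedTriangulatedSurface T) (hD : D ≤ T) (hv : v ∈ interiorVertices D) :
    vertexSet (link T v) ⊆ vertexSet D := by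
  classical
  exact (hv.2.vertexSet_subset_of_le (h.link_isCircle (vertexSet_mono hD hv.1))
    (link_mono hD)).trans vertexSet_link_subset

theorem IsClosedTriangulatedSurface.valence_add_one_le (h : IsClosedTriangulatedSurface T)
    (hD : D ≤ T) (hv : v ∈ interiorVertices D) : valence T v + 1 ≤ numVertices D := by
  classical
  have hvT := vertexSet_mono hD hv.1
  have hnot : v ∉ vertexSet (link T v) := fun hm => (mem_vertexSet_link.1 hm).1 rfl
  rw [← h.numVertices_link hvT, numVertices,
    ← Set.ncard_insert_of_notMem hnot (finite_vertexSet (h.link_isCircle hvT).finite)]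
  exact Set.ncard_le_ncard (Set.insert_subset hv.1 (h.vertexSet_link_subset_of_mem_interior hD hv))
    (finite_vertexSet (h.surface.finite.subset hD))

theorem disjoint_vertexSet (hXY : X ⊓ Y = ⊥) : Disjoint (vertexSet X) (vertexSet Y) := by
  rw [Set.disjoint_left]
  intro v hX hY
  have : ({v} : Finset V) ∈ (X ⊓ Y).faces := ⟨hX, hY⟩
  rw [hXY] at this
  exact this

theorem numVertices_add_le (hT : T.faces.Finite) (hX : X ≤ T) (hY : Y ≤ T) (hXY : X ⊓ Y = ⊥) :
    numVertices X + numVertices Y ≤ numVertices T := by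
  rw [numVertices, numVertices, ← Set.ncard_union_eq (disjoint_vertexSet hXY)
    (finite_vertexSet (hT.subset hX)) (finite_vertexSet (hT.subset hY))]
  exact Set.ncard_le_ncard (Set.union_subset (vertexSet_mono hX) (vertexSet_mono hY))
    (finite_vertexSet hT)

theorem sup_inf_eq_bot (hXZ : X ⊓ Z = ⊥) (hYZ : Y ⊓ Z = ⊥) : (X ⊔ Y) ⊓ Z = ⊥ := by
  refine le_bot_iff.1 fun s hs => ?_
  rcases hs.1 with h | h
  · rw [← hXZ]; exact ⟨h, hs.2⟩
  · rw [← hYZ]; exact ⟨h, hs.2⟩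

/-- Small valences force few vertices: the Euler characteristic is at most two, while each vertex
contributes at least `1 / 3` to it. -/
theorem IsClosedTriangulatedSurface.numVertices_le_six (h : IsClosedTriangulatedSurface T)
    (hM : ∀ v ∈ vertexSet T, valence T v ≤ 4) : numVertices T ≤ 6 := by
  have h1 := h.eulerChar_le_two
  have h2 := h.two_mul_numEdges
  have h3 := numTriangles_mul_three_le h.surface.finite hM
  rw [eulerChar] at h1
  omega

/-- If all valences are at most five, each vertex contributes at least `1 / 6` to the Euler
characteristic. -/
theorem IsClosedTriangulatedSurface.eulerChar_eq_two (h : IsClosedTriangulatedSurface T)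
    (hM : ∀ v ∈ vertexSet T, valence T v ≤ 5) (hV : 7 ≤ numVertices T) : eulerChar T = 2 := by
  have h1 := h.eulerChar_le_two
  have h2 := h.two_mul_numEdges
  have h3 := numTriangles_mul_three_le h.surface.finite hM
  rw [eulerChar] at h1 ⊢
  omega

/-- In a root, the closed star of a 3-valent vertex together with the triangle on its link is
closed under passing to adjacent triangles, so the surface is the boundary of a tetrahedron. -/
theorem IsRoot.numVertices_le_four (hroot : IsRoot T) (h : IsClosedTriangulatedSurface T)
    (hw : w ∈ vertexSet T) (hval : valence T w = 3) : numVertices T ≤ 4 := by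
  classical
  have hC := h.link_isCircle hw
  have hfin := finite_vertexSet hC.finite
  obtain ⟨t, ht⟩ : ∃ t : Finset V, vertexSet (link T w) = ↑t := ⟨hfin.toFinset, by simp⟩
  have htc : t.card = 3 := by
    rw [← Set.ncard_coe_finset, ← ht, ← hval, ← h.numVertices_link hw, numVertices]
  have hwt : w ∉ t := fun hm =>
    (mem_vertexSet_link.1 (ht ▸ Finset.mem_coe.2 hm : w ∈ vertexSet (link T w))).1 rfl
  have hle : link T w ≤ simplex t := fun s hs =>
    ⟨(T.isRelLowerSet_faces hs.1).1, fun x hx => Finset.mem_coe.1 (ht ▸ mem_vertexSet_of_mem hs hx)⟩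
  -- each vertex of the link has two edges there, and only two vertices to join it to
  have hedge : ∀ e ⊆ t, e.card = 2 → insert w e ∈ T.faces := by
    intro e het hec
    obtain ⟨x, hx⟩ : e.Nonempty := Finset.card_pos.1 (by omega)
    have heq : {e | e ∈ edgeSet (link T w) ∧ x ∈ e} =
        {e | e ∈ edgeSet (simplex t) ∧ x ∈ e} := by
      refine Set.eq_of_subset_of_ncard_le (fun e he => ⟨edgeSet_mono hle he.1, he.2⟩) ?_
        ((finite_edgeSet finite_simplex).subset fun e he => he.1)
      have h1 := numEdgesAt_simplex (het hx)
      have h2 := hC.two_edges x (ht ▸ Finset.mem_coe.2 (het hx))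
      rw [numEdgesAt] at h1 h2
      omega
    have : e ∈ {e | e ∈ edgeSet (link T w) ∧ x ∈ e} := by
      rw [heq]; exact ⟨⟨⟨⟨x, hx⟩, het⟩, hec⟩, hx⟩
    exact (mem_link_faces.1 this.1.1).2.2
  have htT : t ∈ T.faces := by
    by_contra hnot
    have hlow : IsRelLowerSet ({s | s ∈ T.faces ∧ w ∉ s} ∪ {t}) Finset.Nonempty := by
      rintro s (⟨hs, hws⟩ | rfl)
      · exact ⟨(T.isRelLowerSet_faces hs).1, fun u hu hne =>
          Or.inl ⟨mem_faces_of_subset hs hu hne, fun h => hws (hu h)⟩⟩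
      · refine ⟨Finset.card_pos.1 (by omega), fun u hu hne => ?_⟩
        by_cases hus : u = s
        · exact Or.inr hus
        have hlt := Finset.card_lt_card (Finset.ssubset_iff_subset_ne.2 ⟨hu, hus⟩)
        obtain ⟨e, hue, hes, hec⟩ := Finset.exists_subsuperset_card_eq hu
          (by omega : u.card ≤ 2) (by omega : 2 ≤ s.card)
        exact Or.inl ⟨mem_faces_of_subset (hedge e hes hec)
          (hue.trans (Finset.subset_insert _ _)) hne, fun h => hwt (hu h)⟩
    exact hroot ⟨⟨_, hlow⟩, w, hw, t, hval, ht, hnot, rfl⟩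
  have hall : triangleSet T ⊆ {s | s ∈ triangleSet T ∧ (w ∈ s ∨ s = t)} := by
    refine h.surface.triangleSet_subset (fun s hs => hs.1) ⟨t, ⟨htT, htc⟩, Or.inr rfl⟩ ?_
    rintro e he s ⟨hs, hws⟩ s' hs' hes hes'
    refine ⟨hs', ?_⟩
    by_cases hwe : w ∈ e
    · exact Or.inl (hes' hwe)
    have het : e ⊆ t := by
      rcases hws with hws | rfl
      · intro x hx
        have hxw : w ≠ x := fun h => hwe (h ▸ hx)
        have : x ∈ vertexSet (link T w) :=
          mem_vertexSet_link.2 ⟨hxw, mem_faces_of_subset hs.1 (by grind) (by simp)⟩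
        rwa [ht] at this
      · exact hes
    have h1 : insert w e ∈ triangleSet T :=
      ⟨hedge e het he.2, by rw [Finset.card_insert_of_notMem hwe, he.2]⟩
    rcases h.eq_or_eq_of_edge_subset he h1 ⟨htT, htc⟩ hs' (Finset.subset_insert _ _) het hes'
      (fun heq => hwt (heq ▸ Finset.mem_insert_self _ _)) with rfl | rfl
    exacts [Or.inl (by simp), Or.inr rfl]
  have hsub : vertexSet T ⊆ ↑(insert w t) := by
    intro x hx
    by_cases hxw : x = w
    · simp [hxw]
    obtain ⟨y, hy⟩ := (h.link_isCircle hx).connected.1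
    obtain ⟨hxy, hxy'⟩ := mem_vertexSet_link.1 hy
    obtain ⟨s, hs, hxs, -⟩ := h.surface.exists_triangle_of_edge hxy hxy'
    rcases (hall hs).2 with hws | rfl
    · have : x ∈ vertexSet (link T w) := mem_vertexSet_link.2
        ⟨Ne.symm hxw, mem_faces_of_subset hs.1 (by grind) (by simp)⟩
      rw [ht] at this
      simpa using Or.inr this
    · simpa using Or.inr hxs
  have := Set.ncard_le_ncard hsub (Finset.finite_toSet _)
  rw [Set.ncard_coe_finset, Finset.card_insert_of_notMem hwt, htc] at this
  exact this

end Valence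

/-! ### Minimal decompositions -/

section Decomposition

variable {V : Type*} {T G D D₁ D₂ : PreAbstractSimplicialComplex V}
  {𝒟 : Set (PreAbstractSimplicialComplex V)} {t : Finset V}

theorem notMem_of_mem_triangleSet {X Y : PreAbstractSimplicialComplex V}
    (hXY : IsCircle (X ⊓ Y) ∨ X ⊓ Y = ⊥)
    (ht : t ∈ triangleSet X) : t ∉ Y.faces := by
  intro htY
  have hm : t ∈ (X ⊓ Y).faces := ⟨ht.1, htY⟩
  rcases hXY with hc | hb
  · have := hc.card_le t hm
    rw [ht.2] at this
    omega
  · rw [hb] at hm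
    exact hm

theorem IsDecomposition.main_inf_eq_bot (hT : IsClosedTriangulatedSurface T)
    (h : IsDecomposition T G D 𝒟) (h₁ : D₁ ∈ 𝒟) : D ⊓ D₁ = ⊥ := by
  obtain ⟨t, ht⟩ := h.genus_surface.exists_triangle
  exact hT.inf_eq_bot h.main_le (h.discs_le _ h₁) h.main_disc (h.discs_disc _ h₁)
    (h.main_inf_discs _ h₁) (triangleSet_mono h.genus_le ht)
    (notMem_of_mem_triangleSet h.genus_inf_main ht)
    (notMem_of_mem_triangleSet (h.genus_inf_discs _ h₁) ht)

theorem IsDecomposition.discs_inf_eq_bot (hT : IsClosedTriangulatedSurface T)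
    (h : IsDecomposition T G D 𝒟) (h₁ : D₁ ∈ 𝒟) (h₂ : D₂ ∈ 𝒟) (hne : D₁ ≠ D₂) :
    D₁ ⊓ D₂ = ⊥ := by
  obtain ⟨t, ht⟩ := h.genus_surface.exists_triangle
  exact hT.inf_eq_bot (h.discs_le _ h₁) (h.discs_le _ h₂) (h.discs_disc _ h₁)
    (h.discs_disc _ h₂) (h.discs_inf_discs h₁ h₂ hne) (triangleSet_mono h.genus_le ht)
    (notMem_of_mem_triangleSet (h.genus_inf_discs _ h₁) ht)
    (notMem_of_mem_triangleSet (h.genus_inf_discs _ h₂) ht)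

/-- With two further discs, the maximal valence would be at most four, leaving room for at most six
vertices. -/
theorem IsDecomposition.discs_subsingleton (hT : IsClosedTriangulatedSurface T)
    (hV : numVertices T ≤ 11) (h : IsDecomposition T G D 𝒟) : 𝒟.Subsingleton := by
  intro D₁ h₁ D₂ h₂
  by_contra hne
  obtain ⟨v, hvD, hvT⟩ := h.exists_maxValence
  have e1 := numVertices_add_le hT.surface.finite (sup_le h.main_le (h.discs_le _ h₁))
    (h.discs_le _ h₂) (sup_inf_eq_bot (h.main_inf_eq_bot hT h₂) (h.discs_inf_eq_bot hT h₁ h₂ hne))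
  have e2 := numVertices_add_le (h.main_disc.surface.finite.union
    (h.discs_disc _ h₁).surface.finite : (D ⊔ D₁).faces.Finite) le_sup_left le_sup_right
    (h.main_inf_eq_bot hT h₁)
  have e3 := (h.discs_disc _ h₁).surface.three_le_numVertices
  have e4 := (h.discs_disc _ h₂).surface.three_le_numVertices
  have e5 := hT.valence_add_one_le h.main_le hvD
  have e6 := hT.numVertices_le_six fun w hw => (hvT.2 w hw).trans (by omega)
  have e7 := hT.three_le_valence hvT.1
  omega

/-- The genus-surface of a decomposition with a further disc has more than one triangle: otherwise
the main disc and the further disc would both contain edges of that triangle. -/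
theorem IsDecomposition.one_lt_numTriangles (hT : IsClosedTriangulatedSurface T)
    (h : IsDecomposition T G D 𝒟) (h𝒟 : 𝒟 = {D₁}) : 1 < numTriangles G := by
  classical
  have h₁ : D₁ ∈ 𝒟 := h𝒟 ▸ rfl
  have hbot := h.main_inf_eq_bot hT h₁
  by_contra hle
  obtain ⟨t, ht⟩ := h.genus_surface.exists_triangle
  have honly : ∀ s ∈ triangleSet G, s = t := fun s hs =>
    (Set.ncard_le_one (finite_triangleSet h.genus_surface.finite)).1 (not_lt.1 hle) s hs t ht
  have hcases : ∀ s ∈ triangleSet T, s = t ∨ s ∈ D.faces ∨ s ∈ D₁.faces := by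
    rintro s ⟨hs, hc⟩
    rw [← h.union_eq, h𝒟, sSup_singleton] at hs
    rcases hs with (hs | hs) | hs
    exacts [Or.inl (honly s ⟨hs, hc⟩), Or.inr (Or.inl hs), Or.inr (Or.inr hs)]
  have hdisj : ∀ s : Finset V, s ∈ D.faces → s ∉ D₁.faces := fun s hs hs₁ => by
    have : s ∈ (D ⊓ D₁).faces := ⟨hs, hs₁⟩
    rw [hbot] at this
    exact this
  have hedge : ∀ X Y : PreAbstractSimplicialComplex V, X ≤ T → IsTriangulatedSurface X →
      (∀ s ∈ triangleSet T, s = t ∨ s ∈ X.faces ∨ s ∈ Y.faces) →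
      (∀ s : Finset V, s ∈ X.faces → s ∉ Y.faces) → t ∉ X.faces →
      ∃ e ∈ edgeSet X, e ⊆ t := by
    intro X Y hXT hX hXY hd htX
    by_contra hcon
    push Not at hcon
    refine htX (hT.surface.triangleSet_subset (triangleSet_mono hXT) hX.exists_triangle ?_
      (triangleSet_mono h.genus_le ht)).1
    intro e he s hs s' hs' hes hes'
    have heX : e ∈ edgeSet X :=
      ⟨mem_faces_of_subset hs.1 hes (Finset.card_pos.1 (by rw [he.2]; norm_num)), he.2⟩
    rcases hXY s' hs' with rfl | hX' | hY'
    · exact absurd hes' (hcon e heX)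
    · exact ⟨hX', hs'.2⟩
    · exact absurd (mem_faces_of_subset hY' hes' (T.isRelLowerSet_faces he.1).1) (hd e heX.1)
  obtain ⟨e, he, het⟩ := hedge D D₁ h.main_le h.main_disc.surface hcases hdisj
    (notMem_of_mem_triangleSet h.genus_inf_main ht)
  obtain ⟨f, hf, hft⟩ := hedge D₁ D (h.discs_le _ h₁) (h.discs_disc _ h₁).surface
    (fun s hs => (hcases s hs).imp_right Or.symm) (fun s hs hs' => hdisj s hs' hs)
    (notMem_of_mem_triangleSet (h.genus_inf_discs _ h₁) ht)
  -- two edges of a triangle have a common vertex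
  have hcard := Finset.card_union_add_card_inter e f
  have := Finset.card_le_card (Finset.union_subset het hft)
  rw [ht.2] at this
  rw [he.2, hf.2] at hcard
  obtain ⟨x, hx⟩ : (e ∩ f).Nonempty := Finset.card_pos.1 (by omega)
  have hx := Finset.mem_inter.1 hx
  exact Set.disjoint_left.1 (disjoint_vertexSet hbot) (mem_vertexSet_of_mem he.1 hx.1)
    (mem_vertexSet_of_mem hf.1 hx.2)

/-- An interior vertex of the further disc would leave only the case of maximal valence five and
eleven vertices. The surface would then be a sphere, which has a decomposition whose genus-surface
is a single triangle, so minimality excludes a further disc. -/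
theorem IsMinimalDecomposition.interiorVertices_eq_empty (hT : IsClosedTriangulatedSurface T)
    (hroot : IsRoot T) (hV : numVertices T ≤ 11) (h : IsMinimalDecomposition T G D 𝒟)
    (h𝒟 : 𝒟 = {D₁}) : interiorVertices D₁ = ∅ := by
  by_contra hne
  obtain ⟨w, hw⟩ := Set.nonempty_iff_ne_empty.2 hne
  have hd := h.decomposition
  have h₁ : D₁ ∈ 𝒟 := h𝒟 ▸ rfl
  have h₁T := hd.discs_le _ h₁
  have hbot := hd.main_inf_eq_bot hT h₁
  obtain ⟨v, hvD, hvT⟩ := hd.exists_maxValence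
  have hwT := vertexSet_mono h₁T hw.1
  have e1 := numVertices_add_le hT.surface.finite hd.main_le h₁T hbot
  have e2 := hT.valence_add_one_le hd.main_le hvD
  have e3 := hT.valence_add_one_le h₁T hw
  have e4 := hT.three_le_valence hvT.1
  have e5 := hT.three_le_valence hwT
  -- the root property excludes that `D₁` is the star of a 3-valent vertex
  have e6 : 5 ≤ numVertices D₁ := by
    rcases e5.eq_or_lt with h3 | h3
    · have := hroot.numVertices_le_four hT hwT h3.symm
      omega
    · omega
  have e7 : ¬ valence T v ≤ 4 := fun hle => by
    have := hT.numVertices_le_six fun x hx => (hvT.2 x hx).trans hle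
    omega
  have hχ : eulerChar T = 2 :=
    hT.eulerChar_eq_two (fun x hx => (hvT.2 x hx).trans (by omega)) (by omega)
  obtain ⟨t, ht⟩ := (hd.discs_disc _ h₁).surface.exists_triangle
  have hvt : v ∉ t := fun hvt =>
    Set.disjoint_left.1 (disjoint_vertexSet hbot) hvD.1 (mem_vertexSet_of_mem ht.1 hvt)
  have hle := h.minimal _ _ _
    (hT.isDecomposition_simplex_deletion hχ (triangleSet_mono h₁T ht) hvT hvt)
  have hone : numTriangles (simplex t) ≤ 1 := by
    refine (Set.ncard_le_one (finite_triangleSet finite_simplex)).2 fun a ha b hb => ?_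
    rw [Finset.eq_of_subset_of_card_le ha.1.2 (by rw [ht.2, ha.2]),
      Finset.eq_of_subset_of_card_le hb.1.2 (by rw [ht.2, hb.2])]
  have := hd.one_lt_numTriangles hT h𝒟
  omega

end Decomposition

end TriSurf

theorem mainTheorem3 {V : Type*} (T : PreAbstractSimplicialComplex V)
    (hT : TriSurf.IsClosedTriangulatedSurface T) (hroot : TriSurf.IsRoot T)
    (hV : TriSurf.numVertices T ≤ 11)
    (G D : PreAbstractSimplicialComplex V) (𝒟 : Set (PreAbstractSimplicialComplex V))
    (hmin : TriSurf.IsMinimalDecomposition T G D 𝒟) :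
    𝒟 = ∅ ∨ ∃ D₁, 𝒟 = {D₁} ∧ TriSurf.interiorVertices D₁ = ∅ := by
  rcases (hmin.decomposition.discs_subsingleton hT hV).eq_empty_or_singleton with h | ⟨D₁, h⟩
  · exact Or.inl h
  · exact Or.inr ⟨D₁, h, hmin.interiorVertices_eq_empty hT hroot hV h⟩
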